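/- Let $d,N\ge 1$ be integers and let $\mathbf S^d\subset\mathbf R^{d+1}$ be the Euclidean unit sphere. For $x,y\in\mathbf S^d$ put $\rho(x,y)=\arccos(x\cdot y)$ and $\Lambda(x,y)=\frac2\pi\min\{\rho(x,y),\pi-\rho(x,y)\}\in[0,1]$. For $0<\alpha<\infty$ let $\Lambda^\alpha$ be the usual power of $\Lambda$, and let $\Lambda^\infty$ and $\Lambda^0$ be its pointwise limits as $\alpha\to\infty$ and $\alpha\to0^+$: $\Lambda^\infty(x,y)=1$ if $x\cdot y=0$ and $0$ otherwise, while $\Lambda^0(x,y)=0$ if $y=\pm x$ and $1$ otherwise. For $\alpha\in[0,\infty]$ and a Borel probability measure $\mu$ on $\mathbf S^d$ put $$E_\alpha(\mu)=\frac12\iint\Lambda^\alpha(x,y)\,d\mu(x)\,d\mu(y).$$ Let $\mathcal P_N^=(\mathbf S^d)$ be the set of measures $\frac1N\sum_{i=1}^N\delta_{x_i}$ with $x_1,\dots,x_N\in\mathbf S^d$ (not necessarily distinct), and let $\mathcal P_{N,\Delta}^=(\mathbf S^d)$ be the set of measures $\frac1N\sum_{i=1}^N\delta_{x_i}$ for which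 there is an orthonormal basis $v_1,\dots,v_{d+1}$ of $\mathbf R^{d+1}$ such that $x_i\in\{v_j,-v_j\}$ whenever $i\equiv j \pmod{d+1}$. Write $\operatorname{argmax}E_\alpha$ for the set of maximizers of $E_\alpha$ over $\mathcal P_N^=(\mathbf S^d)$. There is a unique $\alpha_{\Delta^d}(N)\in[0,\infty]$ such that - $\mathcal P_{N,\Delta}^=(\mathbf S^d)\cap\operatorname{argmax}E_\alpha=\emptyset$ whenever $0<\alpha<\alpha_{\Delta^d}(N)$, and - $\mathcal P_{N,\Delta}^=(\mathbf S^d)=\operatorname{argmax}E_\alpha$ whenever $\alpha_{\Delta^d}(N)<\alpha\le\infty$. **Theorem (Finiteness of discrete threshold exponent).** This threshold exponent (whose existence and uniqueness are part of the claim) is finite, $\alpha_{\Delta^d}(N)\in[0,\infty)$, and $$\mathcal P_{N,\Delta}^=(\mathbf S^d)\subseteq\operatorname{argmax}E_{\alpha_{\Delta^d}(N)}.$$ Moreover, if $N\ge2$, then this inclusion is strict. -/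

import Mathlib

open MeasureTheory
open scoped ENNReal

noncomputable section

namespace FejesToth

/-- The Euclidean unit sphere of `ℝ^(d+1)`. -/
abbrev Sph (d : ℕ) : Type := Metric.sphere (0 : EuclideanSpace ℝ (Fin (d + 1))) 1

/-- The geodesic distance on the sphere. -/
def rho {d : ℕ} (x y : Sph d) : ℝ :=
  Real.arccos (inner ℝ (x : EuclideanSpace ℝ (Fin (d + 1))) (y : EuclideanSpace ℝ (Fin (d + 1))))

/-- The profile `t ↦ (2 / π) min {t, π - t}` on `[0, π]`. -/
def lam0 (t : ℝ) : ℝ := 2 / Real.pi * min t (Real.pi - t)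

/-- The distance on projective space, rescaled to have unit diameter. -/
def lam {d : ℕ} (x y : Sph d) : ℝ := lam0 (rho x y)

/-- The kernel `Λ^α` for `α ∈ [0, ∞]`. It is the ordinary power for `0 < α < ∞`. The end-points are
the pointwise limits: `Λ^∞ (x, y)` is `1` if `x ⬝ y = 0` and `0` otherwise, and `Λ^0 (x, y)` is `0`
if `y = x` or `y = -x` (that is, if `Λ (x, y) = 0`) and `1` otherwise. -/
def kernelPow {d : ℕ} (α : ℝ≥0∞) (x y : Sph d) : ℝ :=
  open Classical in
  if α = ∞ then
    if inner ℝ (x : EuclideanSpace ℝ (Fin (d + 1))) (y : EuclideanSpace ℝ (Fin (d + 1))) = 0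
      then 1 else 0
  else if α = 0 then
    if lam x y = 0 then 0 else 1
  else lam x y ^ α.toReal

/-- The bilinear form `B_α`, here on positive measures. -/
def bilin {d : ℕ} (α : ℝ≥0∞) (μ ν : Measure (Sph d)) : ℝ :=
  ∫ y, ∫ x, kernelPow α x y ∂μ ∂ν

/-- The energy `E_α (μ) = B_α (μ, μ) / 2`. -/
def energy {d : ℕ} (α : ℝ≥0∞) (μ : Measure (Sph d)) : ℝ :=
  1 / 2 * bilin α μ μ

/-- The uniform measure `(1 / N) ∑ δ_{x_i}` on an `N`-tuple of points (repetitions allowed). -/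
def uniformOn {d N : ℕ} (x : Fin N → Sph d) : Measure (Sph d) :=
  (N : ℝ≥0∞)⁻¹ • ∑ i, Measure.dirac (x i)

/-- The uniform `N`-point probability measures on the sphere. -/
def PN (d N : ℕ) : Set (Measure (Sph d)) :=
  {μ | ∃ x : Fin N → Sph d, μ = uniformOn x}

/-- The uniform `N`-point measures whose points are distributed as evenly as possible over the
lines spanned by an orthonormal basis: `x_i ∈ {v_j, -v_j}` whenever `i ≡ j` modulo `d + 1`. -/
def PNDelta (d N : ℕ) : Set (Measure (Sph d)) :=
  {μ | ∃ v : OrthonormalBasis (Fin (d + 1)) ℝ (EuclideanSpace ℝ (Fin (d + 1))),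
    ∃ x : Fin N → Sph d, μ = uniformOn x ∧
      ∀ (i : Fin N) (j : Fin (d + 1)), (i : ℕ) ≡ (j : ℕ) [MOD d + 1] →
        (x i : EuclideanSpace ℝ (Fin (d + 1))) = v j ∨
        (x i : EuclideanSpace ℝ (Fin (d + 1))) = -v j}

/-- The set of maximizers of `E_α` over the uniform `N`-point measures. -/
def argmaxE (d N : ℕ) (α : ℝ≥0∞) : Set (Measure (Sph d)) :=
  {μ | μ ∈ PN d N ∧ ∀ ν ∈ PN d N, energy α ν ≤ energy α μ}

/-- `a ∈ [0, ∞]` is a discrete threshold exponent: below it no even distribution over an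
orthonormal basis is a maximizer, above it these are exactly the maximizers. -/
def IsThreshold (d N : ℕ) (a : ℝ≥0∞) : Prop :=
  (∀ α : ℝ≥0∞, 0 < α → α < a → Disjoint (PNDelta d N) (argmaxE d N α)) ∧
  (∀ α : ℝ≥0∞, a < α → PNDelta d N = argmaxE d N α)

end FejesToth

end

open Filter Topology

namespace FejesToth

variable {d N : ℕ}

/-! Clear the constants and compare the sums `pairSum` of `Λ^α` over ordered pairs. An even
distribution over an orthonormal basis only sees the values 0 and 1 of `Λ`, so its sum is `evenPairs
d N` for every `α`, while every other sum is antitone in `α`. Hence once the even distributions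
maximize, they still do for larger exponents, and there any maximizer must also have `Λ ∈ {0, 1}` on
all pairs. At `α = ∞` the sum counts edges of the orthogonality graph, which has no clique on `d +
2` vertices; Turán's theorem with its equality case (`exists_basis_of_le_pairSum_top`) identifies
the maximizers. The threshold is therefore the infimum of the exponents at which even distributions
maximize.

Finiteness and strictness for `a > 1` share one compactness argument, `exists_not_mem_PNDelta`:
tuples beating the even ones at exponents increasing to `a` accumulate at a tuple at least as good
at `a`. It cannot be even, because even tuples are local maxima for exponents above 1
(`exists_pairSum_le_of_near_basis`): tilting classes apart costs linearly in the inner products,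
while the gain within a class is of higher order. For `a = ∞` this contradicts Turán. For `a ≤ 1`
explicit competitors give strictness: `exists_rotated` for `0 < a`, `exists_spread` for `a = 0`. -/

/-! ### The kernel: bounds, monotonicity and continuity -/

lemma lam_eq (x y : Sph d) :
    lam x y = 2 / Real.pi * Real.arccos |inner ℝ (x : EuclideanSpace ℝ (Fin (d + 1))) y| := by
  unfold lam lam0 rho
  congr 1
  rw [← Real.arccos_neg]
  rcases abs_cases (inner ℝ (x : EuclideanSpace ℝ (Fin (d + 1))) (y : EuclideanSpace ℝ (Fin (d + 1))))
    with ⟨h, h'⟩ | ⟨h, h'⟩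
  · rw [h, min_eq_left]
    exact Real.antitone_arccos (by linarith)
  · rw [h, min_eq_right]
    exact Real.antitone_arccos (by linarith)

lemma lam_comm (x y : Sph d) : lam x y = lam y x := by
  rw [lam_eq, lam_eq, real_inner_comm]

lemma lam_nonneg (x y : Sph d) : 0 ≤ lam x y := by
  rw [lam_eq]
  have := Real.arccos_nonneg |inner ℝ (x : EuclideanSpace ℝ (Fin (d + 1))) y|
  positivity

/-- Follows from `t ≤ arcsin t`. This is the linear cost of leaving orthogonality in the local
maximum argument. -/
lemma lam_le_one_sub (x y : Sph d) :
    lam x y ≤ 1 - 2 / Real.pi * |inner ℝ (x : EuclideanSpace ℝ (Fin (d + 1))) y| := by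
  rw [lam_eq, Real.arccos_eq_pi_div_two_sub_arcsin]
  have h1 : |inner ℝ (x : EuclideanSpace ℝ (Fin (d + 1))) (y : EuclideanSpace ℝ (Fin (d + 1)))| ≤ 1 := by
    have := abs_real_inner_le_norm (x : EuclideanSpace ℝ (Fin (d + 1))) y
    simpa using this
  set t := |inner ℝ (x : EuclideanSpace ℝ (Fin (d + 1))) (y : EuclideanSpace ℝ (Fin (d + 1)))|
  have h0 : 0 ≤ t := abs_nonneg _
  have h2 : t ≤ Real.arcsin t := by
    have := Real.sin_le (Real.arcsin_nonneg.2 h0)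
    rwa [Real.sin_arcsin (by linarith) h1] at this
  have hpi : 2 / Real.pi * (Real.pi / 2) = 1 := by field_simp
  have h3 : 2 / Real.pi * t ≤ 2 / Real.pi * Real.arcsin t := by gcongr
  rw [mul_sub, hpi]
  linarith

lemma lam_le_one (x y : Sph d) : lam x y ≤ 1 := by
  refine (lam_le_one_sub x y).trans ?_
  have : 0 ≤ 2 / Real.pi * |inner ℝ (x : EuclideanSpace ℝ (Fin (d + 1))) y| := by positivity
  linarith

lemma lam_eq_one_iff (x y : Sph d) :
    lam x y = 1 ↔ inner ℝ (x : EuclideanSpace ℝ (Fin (d + 1))) y = 0 := by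
  constructor
  · intro h
    have := lam_le_one_sub x y
    rw [h] at this
    by_contra h0
    have : 0 < 2 / Real.pi * |inner ℝ (x : EuclideanSpace ℝ (Fin (d + 1))) y| := by positivity
    linarith
  · intro h
    rw [lam_eq, h, abs_zero, Real.arccos_zero]
    field_simp

lemma lam_eq_zero_of_smul {x y : Sph d} {s : ℝ}
    (h : (x : EuclideanSpace ℝ (Fin (d + 1))) = s • (y : EuclideanSpace ℝ (Fin (d + 1)))) :
    lam x y = 0 := by
  have hs : |s| = 1 := by
    have h1 : ‖(x : EuclideanSpace ℝ (Fin (d + 1)))‖ = 1 := by simp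
    rw [h, norm_smul] at h1
    simpa using h1
  rw [lam_eq, h, real_inner_smul_left, real_inner_self_eq_norm_sq, abs_mul, hs]
  simp

@[simp] lemma lam_self (x : Sph d) : lam x x = 0 :=
  lam_eq_zero_of_smul (s := 1) (by simp)

/-- Jordan's inequality for the chord `2 sin (θ / 2)`. The vectors `u`, `v` stand for `x`, `y` up to
signs, which `Λ` ignores. -/
lemma lam_le_norm_sub {x y : Sph d} {u v : EuclideanSpace ℝ (Fin (d + 1))} (hu : ‖u‖ = 1)
    (hv : ‖v‖ = 1)
    (h : |inner ℝ (x : EuclideanSpace ℝ (Fin (d + 1))) y| = |inner ℝ u v|) :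
    lam x y ≤ ‖u - v‖ := by
  rw [lam_eq, h]
  set θ := Real.arccos (inner ℝ u v) with hθ
  have h1 : Real.arccos |inner ℝ u v| ≤ θ := Real.antitone_arccos (le_abs_self _)
  have hb : |inner ℝ u v| ≤ 1 := by simpa [hu, hv] using abs_real_inner_le_norm u v
  have hc : Real.cos θ = inner ℝ u v :=
    Real.cos_arccos (by linarith [neg_abs_le (inner ℝ u v)]) (by linarith [le_abs_self (inner ℝ u v)])
  have h0 : 0 ≤ θ := Real.arccos_nonneg _
  have hpi : θ ≤ Real.pi := Real.arccos_le_pi _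
  have hs : 2 / Real.pi * (θ / 2) ≤ Real.sin (θ / 2) :=
    Real.mul_le_sin (by linarith) (by linarith)
  have hn : ‖u - v‖ ^ 2 = (2 * Real.sin (θ / 2)) ^ 2 := by
    rw [norm_sub_sq_real, hu, hv, ← hc]
    have : Real.cos θ = 1 - 2 * Real.sin (θ / 2) ^ 2 := by
      rw [Real.sin_sq_eq_half_sub]
      rw [show 2 * (θ / 2) = θ by ring]
      ring
    rw [this]; ring
  have hs0 : 0 ≤ Real.sin (θ / 2) := le_trans (by positivity) hs
  have : ‖u - v‖ = 2 * Real.sin (θ / 2) :=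
    (sq_eq_sq₀ (norm_nonneg _) (by positivity)).1 hn
  rw [this]
  have h2 : 2 / Real.pi * Real.arccos |inner ℝ u v| ≤ 2 / Real.pi * θ := by gcongr
  linarith

lemma continuous_lam {X : Type*} [TopologicalSpace X] {f g : X → Sph d} (hf : Continuous f)
    (hg : Continuous g) : Continuous fun z => lam (f z) (g z) := by
  simp only [lam_eq]
  fun_prop

lemma kernelPow_comm (α : ℝ≥0∞) (x y : Sph d) : kernelPow α x y = kernelPow α y x := by
  unfold kernelPow
  rw [lam_comm, real_inner_comm]

lemma kernelPow_of_lam_eq_zero (α : ℝ≥0∞) {x y : Sph d} (h : lam x y = 0) :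
    kernelPow α x y = 0 := by
  unfold kernelPow
  have h1 : ¬ inner ℝ (x : EuclideanSpace ℝ (Fin (d + 1))) y = 0 := by
    rw [← lam_eq_one_iff, h]; norm_num
  split_ifs with h2 h3
  · rfl
  · rfl
  · rw [h, Real.zero_rpow]
    exact (ENNReal.toReal_pos h3 h2).ne'

lemma kernelPow_of_lam_eq_one (α : ℝ≥0∞) {x y : Sph d} (h : lam x y = 1) :
    kernelPow α x y = 1 := by
  unfold kernelPow
  have h1 := (lam_eq_one_iff x y).1 h
  simp [h1, h]

lemma kernelPow_of_pos {α : ℝ≥0∞} {x y : Sph d} (h : 0 < lam x y) (hα : α ≠ ∞) :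
    kernelPow α x y = lam x y ^ α.toReal := by
  unfold kernelPow
  rw [if_neg hα]
  split_ifs with h1 h2
  · exact absurd h2 h.ne'
  · simp [h1]
  · rfl

lemma kernelPow_of_ne_zero {α : ℝ≥0∞} (x y : Sph d) (h0 : α ≠ 0) (hα : α ≠ ∞) :
    kernelPow α x y = lam x y ^ α.toReal := by
  unfold kernelPow
  rw [if_neg hα, if_neg h0]

lemma kernelPow_top_of_lt_one {x y : Sph d} (h : lam x y < 1) :
    kernelPow ∞ x y = 0 := by
  unfold kernelPow
  rw [if_pos rfl, if_neg]
  rw [← lam_eq_one_iff]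
  exact h.ne

lemma kernelPow_nonneg (α : ℝ≥0∞) (x y : Sph d) : 0 ≤ kernelPow α x y := by
  unfold kernelPow
  split_ifs <;> first | positivity | exact Real.rpow_nonneg (lam_nonneg x y) _

lemma kernelPow_antitone (x y : Sph d) : Antitone fun α => kernelPow α x y := by
  intro α β h
  rcases (lam_nonneg x y).eq_or_lt with h0 | h0
  · simp [kernelPow_of_lam_eq_zero _ h0.symm]
  rcases (lam_le_one x y).eq_or_lt with h1 | h1
  · simp [kernelPow_of_lam_eq_one _ h1]
  by_cases hβ : β = ∞
  · simp only [hβ, kernelPow_top_of_lt_one h1]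
    exact kernelPow_nonneg _ _ _
  · have hα : α ≠ ∞ := fun h' => hβ (top_le_iff.1 (h' ▸ h))
    simp only [kernelPow_of_pos h0 hα, kernelPow_of_pos h0 hβ]
    exact Real.rpow_le_rpow_of_exponent_ge h0 h1.le (ENNReal.toReal_mono hβ h)

lemma kernelPow_lt {x y : Sph d} (h0 : 0 < lam x y) (h1 : lam x y < 1) {α β : ℝ≥0∞}
    (h : α < β) : kernelPow β x y < kernelPow α x y := by
  have hα : α ≠ ∞ := h.ne_top
  by_cases hβ : β = ∞
  · simp only [hβ, kernelPow_top_of_lt_one h1, kernelPow_of_pos h0 hα]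
    positivity
  · simp only [kernelPow_of_pos h0 hα, kernelPow_of_pos h0 hβ]
    exact Real.rpow_lt_rpow_of_exponent_gt h0 h1 ((ENNReal.toReal_lt_toReal hα hβ).2 h)

lemma kernelPow_le_one (α : ℝ≥0∞) (x y : Sph d) : kernelPow α x y ≤ 1 := by
  refine (kernelPow_antitone x y (zero_le (a := α))).trans ?_
  unfold kernelPow
  simp only [ENNReal.zero_ne_top, if_false, if_true]
  split_ifs <;> norm_num

lemma continuous_kernelPow_exponent (x y : Sph d) : Continuous fun α => kernelPow α x y := by
  rcases (lam_nonneg x y).eq_or_lt with h0 | h0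
  · simp only [kernelPow_of_lam_eq_zero _ h0.symm]; fun_prop
  rcases (lam_le_one x y).eq_or_lt with h1 | h1
  · simp only [kernelPow_of_lam_eq_one _ h1]; fun_prop
  rw [continuous_iff_continuousAt]
  intro α
  -- At `∞` monotonicity reduces the claim to `Λ ^ n → 0` along natural exponents.
  by_cases hα : α = ∞
  · subst hα
    have ht : Tendsto (fun n : ℕ => lam x y ^ n) atTop (𝓝 0) :=
      tendsto_pow_atTop_nhds_zero_of_lt_one h0.le h1
    rw [ContinuousAt, kernelPow_top_of_lt_one h1, Metric.tendsto_nhds]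
    intro ε hε
    obtain ⟨n, hn⟩ := (ht.eventually (gt_mem_nhds hε)).exists
    filter_upwards [lt_mem_nhds (ENNReal.natCast_lt_top n)] with β hβ
    rw [dist_zero_right, Real.norm_of_nonneg (kernelPow_nonneg _ _ _)]
    refine (kernelPow_antitone x y hβ.le).trans_lt ?_
    simp only [kernelPow_of_pos h0 (ENNReal.natCast_ne_top n), ENNReal.toReal_natCast,
      Real.rpow_natCast]
    exact hn
  · have h2 : ContinuousAt (fun β : ℝ≥0∞ => lam x y ^ β.toReal) α :=
      (Real.continuousAt_const_rpow h0.ne').comp (ENNReal.continuousAt_toReal hα)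
    refine h2.congr ?_
    filter_upwards [isOpen_ne.mem_nhds hα] with β hβ
    exact (kernelPow_of_pos h0 hβ).symm

lemma continuous_kernelPow {X : Type*} [TopologicalSpace X] {α : ℝ≥0∞} (h0 : α ≠ 0) (hα : α ≠ ∞)
    {f g : X → Sph d} (hf : Continuous f) (hg : Continuous g) :
    Continuous fun z => kernelPow α (f z) (g z) := by
  simp only [kernelPow_of_ne_zero _ _ h0 hα]
  exact (continuous_lam hf hg).rpow_const fun _ => Or.inr ENNReal.toReal_nonneg

/-! ### Energies as pair sums -/

/-- The sum of the kernel over all ordered pairs of an `N`-tuple. -/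
noncomputable def pairSum (α : ℝ≥0∞) (x : Fin N → Sph d) : ℝ := ∑ i, ∑ k, kernelPow α (x i) (x k)

/-- The number of ordered pairs of indices in different residue classes modulo `d + 1`. -/
noncomputable def evenPairs (d N : ℕ) : ℝ :=
  ∑ i : Fin N, ∑ k : Fin N, if (i : ℕ) % (d + 1) ≠ (k : ℕ) % (d + 1) then 1 else 0

lemma integral_uniformOn (x : Fin N → Sph d) (f : Sph d → ℝ) :
    ∫ y, f y ∂(uniformOn x) = (N : ℝ)⁻¹ * ∑ i, f (x i) := by
  rw [uniformOn, integral_smul_measure, integral_finsetSum_measure]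
  · simp
  · intro i _
    exact integrable_dirac (by simp)

lemma energy_uniformOn (α : ℝ≥0∞) (x : Fin N → Sph d) :
    energy α (uniformOn x) = 1 / 2 * ((N : ℝ)⁻¹ * ((N : ℝ)⁻¹ * pairSum α x)) := by
  simp only [energy, bilin, integral_uniformOn, pairSum, Finset.mul_sum]
  rw [Finset.sum_comm]

lemma energy_le_iff (hN : 1 ≤ N) (α : ℝ≥0∞) (x y : Fin N → Sph d) :
    energy α (uniformOn x) ≤ energy α (uniformOn y) ↔ pairSum α x ≤ pairSum α y := by
  have : (0 : ℝ) < N := by exact_mod_cast hN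
  have h : (0 : ℝ) < (N : ℝ)⁻¹ := by positivity
  rw [energy_uniformOn, energy_uniformOn, mul_le_mul_iff_of_pos_left (by norm_num),
    mul_le_mul_iff_of_pos_left h, mul_le_mul_iff_of_pos_left h]

lemma pairSum_eq_of_uniformOn_eq (hN : 1 ≤ N) (α : ℝ≥0∞) {x y : Fin N → Sph d}
    (h : uniformOn x = uniformOn y) : pairSum α x = pairSum α y :=
  le_antisymm ((energy_le_iff hN α x y).1 (h ▸ le_rfl)) ((energy_le_iff hN α y x).1 (h ▸ le_rfl))

lemma uniformOn_comp_equiv (x : Fin N → Sph d) (e : Fin N ≃ Fin N) :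
    uniformOn (x ∘ e) = uniformOn x := by
  unfold uniformOn
  congr 1
  exact Equiv.sum_comp e fun i => Measure.dirac (x i)

lemma mem_argmaxE_iff (hN : 1 ≤ N) (α : ℝ≥0∞) (x : Fin N → Sph d) :
    uniformOn x ∈ argmaxE d N α ↔ ∀ y : Fin N → Sph d, pairSum α y ≤ pairSum α x := by
  constructor
  · rintro ⟨-, h⟩ y
    exact (energy_le_iff hN α y x).1 (h _ ⟨y, rfl⟩)
  · intro h
    refine ⟨⟨x, rfl⟩, ?_⟩
    rintro _ ⟨y, rfl⟩
    exact (energy_le_iff hN α y x).2 (h y)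

lemma pairSum_antitone (x : Fin N → Sph d) : Antitone fun α => pairSum α x := fun _ _ h =>
  Finset.sum_le_sum fun _ _ => Finset.sum_le_sum fun _ _ => kernelPow_antitone _ _ h

lemma pairSum_lt {x : Fin N → Sph d} {i k : Fin N} (h0 : 0 < lam (x i) (x k))
    (h1 : lam (x i) (x k) < 1) {α β : ℝ≥0∞} (h : α < β) : pairSum β x < pairSum α x := by
  refine Finset.sum_lt_sum (fun _ _ => Finset.sum_le_sum fun _ _ => kernelPow_antitone _ _ h.le)
    ⟨i, Finset.mem_univ _, ?_⟩
  exact Finset.sum_lt_sum (fun _ _ => kernelPow_antitone _ _ h.le)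
    ⟨k, Finset.mem_univ _, kernelPow_lt h0 h1 h⟩

lemma continuous_pairSum_exponent (x : Fin N → Sph d) : Continuous fun α => pairSum α x :=
  continuous_finsetSum _ fun _ _ => continuous_finsetSum _ fun _ _ =>
    continuous_kernelPow_exponent _ _

lemma continuous_pairSum {α : ℝ≥0∞} (h0 : α ≠ 0) (hα : α ≠ ∞) :
    Continuous fun x : Fin N → Sph d => pairSum α x := by
  unfold pairSum
  exact continuous_finsetSum _ fun i _ => continuous_finsetSum _ fun k _ =>
    continuous_kernelPow h0 hα (continuous_apply i) (continuous_apply k)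

lemma mod_eq_of_modEq {i : ℕ} {j : Fin (d + 1)} (h : i ≡ (j : ℕ) [MOD d + 1]) :
    i % (d + 1) = j := by
  rwa [Nat.ModEq, Nat.mod_eq_of_lt j.2] at h

lemma kernelPow_of_basis (α : ℝ≥0∞)
    (v : OrthonormalBasis (Fin (d + 1)) ℝ (EuclideanSpace ℝ (Fin (d + 1)))) {x y : Sph d}
    {j l : Fin (d + 1)}
    (hx : (x : EuclideanSpace ℝ (Fin (d + 1))) = v j ∨ (x : EuclideanSpace ℝ (Fin (d + 1))) = -v j)
    (hy : (y : EuclideanSpace ℝ (Fin (d + 1))) = v l ∨ (y : EuclideanSpace ℝ (Fin (d + 1))) = -v l) :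
    kernelPow α x y = if j ≠ l then 1 else 0 := by
  split_ifs with h
  · apply kernelPow_of_lam_eq_one
    rw [lam_eq_one_iff]
    have := v.orthonormal.2 h
    rcases hx with hx | hx <;> rcases hy with hy | hy <;> simp [hx, hy, this]
  · push Not at h
    subst h
    apply kernelPow_of_lam_eq_zero
    rcases hx with hx | hx <;> rcases hy with hy | hy
    · exact lam_eq_zero_of_smul (s := 1) (by simp [hx, hy])
    · exact lam_eq_zero_of_smul (s := -1) (by simp [hx, hy])
    · exact lam_eq_zero_of_smul (s := -1) (by simp [hx, hy])
    · exact lam_eq_zero_of_smul (s := 1) (by simp [hx, hy])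

lemma pairSum_of_basis (α : ℝ≥0∞)
    (v : OrthonormalBasis (Fin (d + 1)) ℝ (EuclideanSpace ℝ (Fin (d + 1)))) {x : Fin N → Sph d}
    (h : ∀ (i : Fin N) (j : Fin (d + 1)), (i : ℕ) ≡ (j : ℕ) [MOD d + 1] →
        (x i : EuclideanSpace ℝ (Fin (d + 1))) = v j ∨
        (x i : EuclideanSpace ℝ (Fin (d + 1))) = -v j) :
    pairSum α x = evenPairs d N := by
  unfold pairSum evenPairs
  refine Finset.sum_congr rfl fun i _ => Finset.sum_congr rfl fun k _ => ?_
  have hm (i : Fin N) := h i ⟨i % (d + 1), Nat.mod_lt _ d.succ_pos⟩ (Nat.mod_modEq _ _).symm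
  rw [kernelPow_of_basis α v (hm i) (hm k)]
  simp [Fin.ext_iff]

lemma pairSum_of_mem_PNDelta (hN : 1 ≤ N) (α : ℝ≥0∞) {x : Fin N → Sph d}
    (h : uniformOn x ∈ PNDelta d N) : pairSum α x = evenPairs d N := by
  obtain ⟨v, y, hxy, hy⟩ := h
  rw [pairSum_eq_of_uniformOn_eq hN α hxy, pairSum_of_basis α v hy]

/-- Such a pair makes the sum depend on the exponent, whereas even distributions have a constant
one. -/
lemma not_mem_PNDelta (hN : 1 ≤ N) {x : Fin N → Sph d} {i k : Fin N} (h0 : 0 < lam (x i) (x k))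
    (h1 : lam (x i) (x k) < 1) : uniformOn x ∉ PNDelta d N := fun h => by
  have := pairSum_lt h0 h1 (ENNReal.zero_lt_top)
  rw [pairSum_of_mem_PNDelta hN _ h, pairSum_of_mem_PNDelta hN _ h] at this
  exact lt_irrefl _ this

/-- The point of the sphere given by a unit vector. -/
def toSph (u : EuclideanSpace ℝ (Fin (d + 1))) (hu : ‖u‖ = 1) : Sph d := ⟨u, by simpa using hu⟩

lemma exists_mem_PNDelta (d N : ℕ) : ∃ x : Fin N → Sph d, uniformOn x ∈ PNDelta d N := by
  let v := EuclideanSpace.basisFun (Fin (d + 1)) ℝ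
  let x : Fin N → Sph d := fun i =>
    toSph (v ⟨i % (d + 1), Nat.mod_lt _ d.succ_pos⟩) (v.orthonormal.1 _)
  refine ⟨x, v, x, rfl, fun i j hij => Or.inl ?_⟩
  have : (⟨i % (d + 1), Nat.mod_lt _ d.succ_pos⟩ : Fin (d + 1)) = j :=
    Fin.ext (mod_eq_of_modEq hij)
  simp only [x, toSph, this]

lemma PNDelta_subset_argmaxE_iff (hN : 1 ≤ N) (α : ℝ≥0∞) :
    PNDelta d N ⊆ argmaxE d N α ↔ ∀ y : Fin N → Sph d, pairSum α y ≤ evenPairs d N := by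
  constructor
  · intro h
    obtain ⟨x, hx⟩ := exists_mem_PNDelta d N
    rw [← pairSum_of_mem_PNDelta hN α hx]
    exact (mem_argmaxE_iff hN α x).1 (h hx)
  · rintro h μ ⟨v, x, rfl, hx⟩
    rw [mem_argmaxE_iff hN, pairSum_of_basis α v hx]
    exact h

/-- All even distributions have the same energy, so one of them maximizes only if all do. -/
lemma disjoint_or_subset (hN : 1 ≤ N) (α : ℝ≥0∞) (h : ¬ PNDelta d N ⊆ argmaxE d N α) :
    Disjoint (PNDelta d N) (argmaxE d N α) := by
  rw [Set.disjoint_left]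
  rintro μ ⟨v, x, rfl, hx⟩ hμ
  rw [mem_argmaxE_iff hN, pairSum_of_basis α v hx] at hμ
  exact h ((PNDelta_subset_argmaxE_iff hN α).2 hμ)

lemma mem_argmaxE_of_le (hN : 1 ≤ N) {α : ℝ≥0∞} (h : PNDelta d N ⊆ argmaxE d N α)
    {x : Fin N → Sph d} (hx : evenPairs d N ≤ pairSum α x) : uniformOn x ∈ argmaxE d N α :=
  (mem_argmaxE_iff hN α x).2 fun y => ((PNDelta_subset_argmaxE_iff hN α).1 h y).trans hx

/-! ### The exponent `∞` and Turán's theorem -/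

/-- The orthogonality graph of a tuple of points on the sphere. -/
def orthGraph (x : Fin N → Sph d) : SimpleGraph (Fin N) where
  Adj i k := inner ℝ (x i : EuclideanSpace ℝ (Fin (d + 1))) (x k) = 0
  symm := ⟨fun i k h => by rw [real_inner_comm]; exact h⟩
  loopless := ⟨fun i h => by
    rw [real_inner_self_eq_norm_sq] at h
    simp at h⟩

/-- A clique is an orthonormal family, so its size is at most the dimension `d + 1`. -/
lemma orthGraph_cliqueFree (x : Fin N → Sph d) : (orthGraph x).CliqueFree (d + 1 + 1) := by
  intro s hs
  have ho : Orthonormal ℝ fun i : s => (x i : EuclideanSpace ℝ (Fin (d + 1))) := by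
    refine ⟨fun i => by simp, fun i k hik => ?_⟩
    exact hs.1 i.2 k.2 fun h => hik (Subtype.ext h)
  have := ho.linearIndependent.fintype_card_le_finrank
  simp [hs.2] at this

lemma sum_adj_eq (G : SimpleGraph (Fin N)) [DecidableRel G.Adj] :
    ∑ i, ∑ k, (if G.Adj i k then (1 : ℝ) else 0) = 2 * (G.edgeFinset.card : ℝ) := by
  have := G.sum_degrees_eq_twice_card_edges
  rw [← Nat.cast_ofNat (R := ℝ), ← Nat.cast_mul, ← this, Nat.cast_sum]
  refine Finset.sum_congr rfl fun i _ => ?_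
  rw [Finset.sum_boole, ← SimpleGraph.card_neighborFinset_eq_degree,
    SimpleGraph.neighborFinset_eq_filter]

open Classical in
lemma pairSum_top (x : Fin N → Sph d) :
    pairSum ∞ x = 2 * ((orthGraph x).edgeFinset.card : ℝ) := by
  rw [← sum_adj_eq]
  simp only [pairSum, kernelPow, orthGraph, if_true]
  refine Finset.sum_congr rfl fun i _ => Finset.sum_congr rfl fun k _ => ?_
  congr 1

open Classical in
lemma evenPairs_eq (d N : ℕ) :
    evenPairs d N = 2 * ((SimpleGraph.turanGraph N (d + 1)).edgeFinset.card : ℝ) := by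
  rw [← sum_adj_eq]
  rfl

/-- Equality in Turán's theorem: the points lie on the lines of an orthonormal basis. -/
lemma exists_basis_of_le_pairSum_top {x : Fin N → Sph d} (h : evenPairs d N ≤ pairSum ∞ x) :
    ∃ (v : OrthonormalBasis (Fin (d + 1)) ℝ (EuclideanSpace ℝ (Fin (d + 1))))
      (e : Fin N ≃ Fin N), ∀ (i : Fin N) (j : Fin (d + 1)), (e i : ℕ) ≡ (j : ℕ) [MOD d + 1] →
        (x i : EuclideanSpace ℝ (Fin (d + 1))) = v j ∨
        (x i : EuclideanSpace ℝ (Fin (d + 1))) = -v j := by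
  classical
  rw [pairSum_top, evenPairs_eq] at h
  have hT := SimpleGraph.isTuranMaximal_turanGraph (n := N) d.succ_pos
  have hG : (orthGraph x).IsTuranMaximal (d + 1) := by
    refine ⟨orthGraph_cliqueFree x, fun {H} _ hH => (hT.2 hH).trans ?_⟩
    have h' := le_of_mul_le_mul_left h two_pos
    exact_mod_cast h'
  obtain ⟨e⟩ := hG.nonempty_iso_turanGraph
  rw [Fintype.card_fin] at e
  have he : ∀ i k, inner ℝ (x i : EuclideanSpace ℝ (Fin (d + 1))) (x k) = 0 ↔
      (e i : ℕ) % (d + 1) ≠ (e k : ℕ) % (d + 1) := fun i k =>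
    (e.map_rel_iff (a := i) (b := k)).symm
  let w : Fin (d + 1) → EuclideanSpace ℝ (Fin (d + 1)) := fun j =>
    if hj : (j : ℕ) < N then x (e.symm ⟨j, hj⟩) else 0
  have hw : ∀ (j : Fin (d + 1)) (hj : (j : ℕ) < N), w j = x (e.symm ⟨j, hj⟩) :=
    fun j hj => dif_pos hj
  let s : Set (Fin (d + 1)) := {j | (j : ℕ) < N}
  have hws : Orthonormal ℝ (s.domRestrict w) := by
    constructor
    · rintro ⟨j, hj⟩
      simp [hw j hj]
    · rintro ⟨j, hj⟩ ⟨l, hl⟩ hjl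
      simp only [Set.domRestrict_apply, hw j hj, hw l hl]
      rw [he]
      simp only [RelIso.apply_symm_apply, Nat.mod_eq_of_lt j.2, Nat.mod_eq_of_lt l.2]
      intro h
      exact hjl (Subtype.ext (Fin.ext h))
  obtain ⟨v, hv⟩ := hws.exists_orthonormalBasis_extension_of_card_eq (by simp)
  refine ⟨v, e.toEquiv, fun i j hij => ?_⟩
  have hij : (e i : ℕ) % (d + 1) = j := mod_eq_of_modEq hij
  have hjN : (j : ℕ) < N := hij ▸ (Nat.mod_le _ _).trans_lt (e i).2
  -- If every class is inhabited, `x i` is orthogonal to all basis vectors but `v j`. Otherwise each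
  -- class has at most one point, and `v j` is `x i` itself.
  by_cases hd : d + 1 ≤ N
  · have hx : (x i : EuclideanSpace ℝ (Fin (d + 1))) = inner ℝ (v j) (x i) • v j := by
      conv_lhs => rw [← v.sum_repr' (x i)]
      refine Finset.sum_eq_single j (fun l _ hl => ?_) (by simp)
      have hlN : (l : ℕ) < N := l.2.trans_le hd
      have : inner ℝ (v l) (x i : EuclideanSpace ℝ (Fin (d + 1))) = 0 := by
        rw [hv l hlN, hw l hlN, he, hij]
        simpa [Nat.mod_eq_of_lt l.2, Fin.ext_iff] using hl
      rw [this, zero_smul]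
    have hn : ‖(x i : EuclideanSpace ℝ (Fin (d + 1)))‖ = 1 := by simp
    rw [hx, norm_smul, v.orthonormal.1 j, mul_one, Real.norm_eq_abs] at hn
    rcases (abs_eq zero_le_one).1 hn with h1 | h1
    · left; rw [h1, one_smul] at hx; exact hx
    · right; rw [h1, neg_one_smul] at hx; exact hx
  · left
    have : e i = ⟨j, hjN⟩ := by
      apply Fin.ext
      rw [Nat.mod_eq_of_lt (by omega)] at hij
      exact hij
    rw [hv j hjN, hw j hjN, ← this]
    simp

lemma mem_PNDelta_of_basis {x : Fin N → Sph d}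
    (v : OrthonormalBasis (Fin (d + 1)) ℝ (EuclideanSpace ℝ (Fin (d + 1)))) (e : Fin N ≃ Fin N)
    (h : ∀ (i : Fin N) (j : Fin (d + 1)), (e i : ℕ) ≡ (j : ℕ) [MOD d + 1] →
        (x i : EuclideanSpace ℝ (Fin (d + 1))) = v j ∨
        (x i : EuclideanSpace ℝ (Fin (d + 1))) = -v j) : uniformOn x ∈ PNDelta d N :=
  ⟨v, x ∘ e.symm, (uniformOn_comp_equiv x e.symm).symm, fun i j hij => h (e.symm i) j (by simpa)⟩

lemma mem_PNDelta_of_le_pairSum_top {x : Fin N → Sph d} (h : evenPairs d N ≤ pairSum ∞ x) :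
    uniformOn x ∈ PNDelta d N := by
  obtain ⟨v, e, h⟩ := exists_basis_of_le_pairSum_top h
  exact mem_PNDelta_of_basis v e h

/-- Once the even distributions maximize, they are the only maximizers for larger exponents. -/
lemma PNDelta_eq_argmaxE_of_lt (hN : 1 ≤ N) {α β : ℝ≥0∞} (hαβ : α < β)
    (h : PNDelta d N ⊆ argmaxE d N α) : PNDelta d N = argmaxE d N β := by
  have hα := (PNDelta_subset_argmaxE_iff hN α).1 h
  have hβ : PNDelta d N ⊆ argmaxE d N β := (PNDelta_subset_argmaxE_iff hN β).2 fun y =>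
    (pairSum_antitone y hαβ.le).trans (hα y)
  refine hβ.antisymm ?_
  rintro _ ⟨⟨x, rfl⟩, hx⟩
  have hx := (mem_argmaxE_iff hN β x).1 ⟨⟨x, rfl⟩, hx⟩
  obtain ⟨z, hz⟩ := exists_mem_PNDelta d N
  have hxβ : evenPairs d N ≤ pairSum β x := pairSum_of_mem_PNDelta hN β hz ▸ hx z
  -- An intermediate value would make the sum at `α` strictly exceed the maximum `evenPairs d N`.
  have h01 : ∀ i k, lam (x i) (x k) = 0 ∨ lam (x i) (x k) = 1 := by
    intro i k
    by_contra! hik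
    have := pairSum_lt ((lam_nonneg _ _).lt_of_ne' hik.1) ((lam_le_one _ _).lt_of_ne hik.2) hαβ
    linarith [hα x]
  apply mem_PNDelta_of_le_pairSum_top
  refine hxβ.trans (Finset.sum_le_sum fun i _ => Finset.sum_le_sum fun k _ => ?_)
  rcases h01 i k with h | h
  · simp [kernelPow_of_lam_eq_zero _ h]
  · simp [kernelPow_of_lam_eq_one _ h]

/-! ### Local maximality for exponents above 1, and the limit argument -/

/-- A small perturbation of an orthonormal basis still controls the norm. -/
lemma norm_le_two_mul_sum_inner
    (v : OrthonormalBasis (Fin (d + 1)) ℝ (EuclideanSpace ℝ (Fin (d + 1))))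
    {u : Fin (d + 1) → EuclideanSpace ℝ (Fin (d + 1))} {η : ℝ} (hη : (d + 1) * η ≤ 1 / 2)
    (hu : ∀ l, ‖u l - v l‖ ≤ η) (w : EuclideanSpace ℝ (Fin (d + 1))) :
    ‖w‖ ≤ 2 * ∑ l, |inner ℝ (u l) w| := by
  have h1 : ‖w‖ ≤ ∑ l, |inner ℝ (v l) w| := by
    conv_lhs => rw [← v.sum_repr' w]
    refine (norm_sum_le _ _).trans (Finset.sum_le_sum fun l _ => ?_)
    rw [norm_smul, v.orthonormal.1 l, mul_one, Real.norm_eq_abs]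
  have h2 : ∀ l, |inner ℝ (v l) w| ≤ |inner ℝ (u l) w| + η * ‖w‖ := by
    intro l
    have h3 : inner ℝ (v l) w = inner ℝ (u l) w - inner ℝ (u l - v l) w := by
      rw [inner_sub_left]; ring
    have h4 : |inner ℝ (u l - v l) w| ≤ η * ‖w‖ :=
      (abs_real_inner_le_norm _ _).trans (by gcongr; exact hu l)
    rw [h3]
    exact (abs_sub _ _).trans (by linarith)
  have h5 : ∑ l, |inner ℝ (v l) w| ≤ ∑ l, |inner ℝ (u l) w| + (d + 1) * (η * ‖w‖) := by
    refine (Finset.sum_le_sum fun l _ => h2 l).trans ?_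
    rw [Finset.sum_add_distrib]
    simp
  have h6 : (d + 1) * η * ‖w‖ ≤ 1 / 2 * ‖w‖ := by gcongr
  linarith

/-- Two unit vectors close to the same basis vector are separated by at most the inner products
with nearby representatives of the other basis vectors. -/
lemma norm_sub_le_of_near_basis
    (v : OrthonormalBasis (Fin (d + 1)) ℝ (EuclideanSpace ℝ (Fin (d + 1))))
    {c : Fin N → Fin (d + 1)} (hc : Function.Surjective c)
    {z : Fin N → EuclideanSpace ℝ (Fin (d + 1))} (hz : ∀ i, ‖z i‖ = 1)
    {η : ℝ} (hη : (d + 1) * η ≤ 1 / 2) (hzv : ∀ i, ‖z i - v (c i)‖ ≤ η)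
    {i k : Fin N} (hik : c i = c k) {L : ℝ}
    (hL : ∀ i k, c i ≠ c k → |inner ℝ (z i) (z k)| ≤ L) (hL0 : 0 ≤ L) :
    ‖z i - z k‖ ≤ 4 * (d + 1) * L := by
  obtain ⟨r, hr⟩ := hc.hasRightInverse
  -- In direction `c i` the midpoint is used: as `z i` and `z k` have equal norm, it is orthogonal
  -- to their difference, so only the other classes contribute.
  let u : Fin (d + 1) → EuclideanSpace ℝ (Fin (d + 1)) := fun l =>
    if l = c i then (1 / 2 : ℝ) • (z i + z k) else z (r l)
  have hu : ∀ l, ‖u l - v l‖ ≤ η := by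
    intro l
    by_cases hl : l = c i
    · have h1 : u l - v l = (1 / 2 : ℝ) • ((z i - v (c i)) + (z k - v (c k))) := by
        rw [show u l = (1 / 2 : ℝ) • (z i + z k) from if_pos hl, hl, ← hik]
        module
      rw [h1, norm_smul, Real.norm_of_nonneg (by norm_num)]
      linarith [norm_add_le (z i - v (c i)) (z k - v (c k)), hzv i, hzv k]
    · simp only [u, if_neg hl]
      have := hzv (r l)
      rwa [hr l] at this
  have h2 : ∀ l, |inner ℝ (u l) (z i - z k)| ≤ 2 * L := by
    intro l
    by_cases hl : l = c i
    · have : inner ℝ (u l) (z i - z k) = 0 := by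
        simp only [u, if_pos hl]
        rw [real_inner_smul_left, inner_sub_right, inner_add_left, inner_add_left,
          real_inner_self_eq_norm_sq, real_inner_self_eq_norm_sq, hz, hz, real_inner_comm (z i) (z k)]
        ring
      rw [this, abs_zero]
      positivity
    · simp only [u, if_neg hl, inner_sub_right]
      refine (abs_sub _ _).trans ?_
      have ha := hL (r l) i (by rwa [hr l])
      have hb := hL (r l) k (by rwa [hr l, ← hik])
      linarith
  refine (norm_le_two_mul_sum_inner v hη hu _).trans ?_
  have := Finset.sum_le_sum fun l (_ : l ∈ Finset.univ) => h2 l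
  simp only [Finset.sum_const, Finset.card_univ, Fintype.card_fin, nsmul_eq_mul] at this
  push_cast at this
  linarith

/-- The first bound keeps perturbed bases nondegenerate; the second, with `p = β - 1`, makes the
gain within classes at most the cost between them. -/
lemma exists_radius (K p : ℝ) (hK : 0 ≤ K) (hp : 0 < p) :
    ∃ η : ℝ, 0 < η ∧ (d + 1) * η ≤ 1 / 2 ∧ (2 * η) ^ p * K ≤ 2 / Real.pi := by
  set δ : ℝ := 2 / Real.pi / (K + 1) with hδ
  have hδ0 : 0 < δ := by positivity
  have h1 : 0 < δ ^ p⁻¹ := by positivity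
  refine ⟨min (1 / (2 * (d + 1))) (δ ^ p⁻¹ / 2), by positivity, ?_, ?_⟩
  · calc (d + 1 : ℝ) * min (1 / (2 * (d + 1 : ℝ))) (δ ^ p⁻¹ / 2)
        ≤ (d + 1) * (1 / (2 * (d + 1))) := by gcongr; exact min_le_left _ _
      _ = 1 / 2 := by field_simp
  · have h2 : (2 * min (1 / (2 * (d + 1) : ℝ)) (δ ^ p⁻¹ / 2)) ^ p ≤ δ := by
      calc (2 * min (1 / (2 * (d + 1) : ℝ)) (δ ^ p⁻¹ / 2)) ^ p ≤ (δ ^ p⁻¹) ^ p := by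
            gcongr
            linarith [min_le_right (1 / (2 * (d + 1) : ℝ)) (δ ^ p⁻¹ / 2)]
        _ = δ := Real.rpow_inv_rpow hδ0.le hp.ne'
    calc _ ≤ δ * K := by gcongr
      _ ≤ δ * (K + 1) := by gcongr; linarith
      _ = 2 / Real.pi := by rw [hδ]; field_simp

/-- For exponents larger than `1`, an even distribution is a local maximum. -/
lemma exists_pairSum_le_of_near_basis
    (v : OrthonormalBasis (Fin (d + 1)) ℝ (EuclideanSpace ℝ (Fin (d + 1))))
    {c : Fin N → Fin (d + 1)} (hc : Function.Surjective c) {x : Fin N → Sph d}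
    (hx : ∀ i, (x i : EuclideanSpace ℝ (Fin (d + 1))) = v (c i) ∨
      (x i : EuclideanSpace ℝ (Fin (d + 1))) = -v (c i)) {β : ℝ≥0∞} (h1 : 1 < β) (hβ : β ≠ ∞) :
    ∃ η > 0, ∀ y : Fin N → Sph d, dist y x ≤ η →
      pairSum β y ≤ ∑ i, ∑ k, if c i ≠ c k then 1 else 0 := by
  have hp : 0 < β.toReal - 1 := by
    have := (ENNReal.toReal_lt_toReal ENNReal.one_ne_top hβ).2 h1
    simpa using this
  obtain ⟨η, hη0, hη, hηp⟩ := exists_radius (d := d) (N * (N * (4 * (d + 1)))) _ (by positivity) hp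
  refine ⟨η, hη0, fun y hy => ?_⟩
  have hs : ∀ i, ∃ s : ℝ, |s| = 1 ∧ (x i : EuclideanSpace ℝ (Fin (d + 1))) = s • v (c i) := fun i => by
    rcases hx i with h | h
    · exact ⟨1, by simp, by simp [h]⟩
    · exact ⟨-1, by simp, by simp [h]⟩
  choose s hs1 hs using hs
  have hss : ∀ i, s i * s i = 1 := fun i => by
    rw [← abs_mul_abs_self, hs1, one_mul]
  -- Flip signs so that all points of a class lie near the same basis vector.
  let z : Fin N → EuclideanSpace ℝ (Fin (d + 1)) := fun i => s i • (y i : EuclideanSpace ℝ (Fin (d + 1)))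
  have hz : ∀ i, ‖z i‖ = 1 := fun i => by simp [z, norm_smul, hs1]
  have hzv : ∀ i, ‖z i - v (c i)‖ ≤ η := by
    intro i
    have h2 : z i - v (c i) = s i • ((y i : EuclideanSpace ℝ (Fin (d + 1))) - x i) := by
      rw [hs, smul_sub, smul_smul, hss, one_smul]
    rw [h2, norm_smul, Real.norm_eq_abs, hs1, one_mul, ← dist_eq_norm]
    exact (dist_le_pi_dist y x i).trans hy
  have habs : ∀ i k, |inner ℝ (y i : EuclideanSpace ℝ (Fin (d + 1))) (y k)| =
      |inner ℝ (z i) (z k)| := fun i k => by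
    simp [z, real_inner_smul_left, real_inner_smul_right, abs_mul, hs1]
  let m : Fin N → Fin N → ℝ := fun i k => if c i ≠ c k then |inner ℝ (z i) (z k)| else 0
  have hm0 : ∀ i k, 0 ≤ m i k := fun i k => by
    simp only [m]; split_ifs <;> positivity
  set L := ∑ i, ∑ k, m i k with hL
  have hmL : ∀ i k, m i k ≤ L := fun i k =>
    (Finset.single_le_sum (f := m i) (fun k _ => hm0 i k) (Finset.mem_univ k)).trans
      (Finset.single_le_sum (f := fun i => ∑ k, m i k)
        (fun i _ => Finset.sum_nonneg fun k _ => hm0 i k) (Finset.mem_univ i))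
  have hL0 : 0 ≤ L := Finset.sum_nonneg fun i _ => Finset.sum_nonneg fun k _ => hm0 i k
  have hLi : ∀ i k, c i ≠ c k → |inner ℝ (z i) (z k)| ≤ L := fun i k h => by
    have := hmL i k
    rwa [show m i k = |inner ℝ (z i) (z k)| from if_pos h] at this
  -- Bounds `Λ ^ β = Λ ^ (β - 1) * Λ` within a class: the first factor by the radius, the second by
  -- the total tilt `L`.
  set ε := (2 * η) ^ (β.toReal - 1) * (4 * (d + 1) * L) with hε
  have hε0 : 0 ≤ ε := by positivity
  have key : ∀ i k, kernelPow β (y i) (y k) ≤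
      ((if c i ≠ c k then 1 else 0) - 2 / Real.pi * m i k) + ε := by
    intro i k
    by_cases h : c i = c k
    · have hm : m i k = 0 := if_neg (not_not.2 h)
      rw [if_neg (not_not.2 h), hm, mul_zero, sub_zero, zero_add]
      rcases (lam_nonneg (y i) (y k)).eq_or_lt with h0 | h0
      · rwa [kernelPow_of_lam_eq_zero _ h0.symm]
      rw [kernelPow_of_pos h0 hβ]
      have hl : lam (y i) (y k) ≤ ‖z i - z k‖ := lam_le_norm_sub (hz i) (hz k) (habs i k)
      have hz1 : ‖z i - z k‖ ≤ 4 * (d + 1) * L := norm_sub_le_of_near_basis v hc hz hη hzv h hLi hL0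
      have hz2 : ‖z i - z k‖ ≤ 2 * η := by
        have h3 : z i - z k = (z i - v (c i)) - (z k - v (c k)) := by rw [h]; abel
        rw [h3]
        linarith [norm_sub_le (z i - v (c i)) (z k - v (c k)), hzv i, hzv k]
      calc lam (y i) (y k) ^ β.toReal
          = lam (y i) (y k) ^ (β.toReal - 1) * lam (y i) (y k) := by
            rw [← Real.rpow_add_one h0.ne']; ring_nf
        _ ≤ ε := by
            rw [hε]
            gcongr
            · exact hl.trans hz2
            · exact hl.trans hz1
    · have hm : m i k = |inner ℝ (z i) (z k)| := if_pos h
      rw [if_pos h, hm, ← habs]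
      have h2 : kernelPow β (y i) (y k) ≤ kernelPow 1 (y i) (y k) := kernelPow_antitone _ _ h1.le
      rw [kernelPow_of_ne_zero _ _ one_ne_zero ENNReal.one_ne_top, ENNReal.toReal_one,
        Real.rpow_one] at h2
      linarith [lam_le_one_sub (y i) (y k)]
  calc pairSum β y ≤ ∑ i, ∑ k, (((if c i ≠ c k then 1 else 0) - 2 / Real.pi * m i k) + ε) :=
        Finset.sum_le_sum fun i _ => Finset.sum_le_sum fun k _ => key i k
    _ = (∑ i, ∑ k, if c i ≠ c k then 1 else 0) - 2 / Real.pi * L + N * (N * ε) := by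
        simp only [Finset.sum_add_distrib, Finset.sum_sub_distrib, ← Finset.mul_sum, ← hL,
          Finset.sum_const, Finset.card_univ, Fintype.card_fin, nsmul_eq_mul]
    _ ≤ ∑ i, ∑ k, if c i ≠ c k then 1 else 0 := by
        have : N * (N * ε) ≤ 2 / Real.pi * L := by
          calc N * (N * ε) = (2 * η) ^ (β.toReal - 1) * (N * (N * (4 * (d + 1)))) * L := by
                rw [hε]; ring
            _ ≤ _ := by gcongr
        linarith

/-- A limit of tuples that beat the even distributions, for exponents increasing to `a > 1`, is
a tuple that does at least as well for the exponent `a` without being evenly distributed. -/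
lemma exists_not_mem_PNDelta (hN : d + 1 ≤ N) {a : ℝ≥0∞} (ha : 1 < a)
    (h : ∀ α, 0 < α → α < a → ∃ y : Fin N → Sph d, evenPairs d N < pairSum α y) :
    ∃ x : Fin N → Sph d, evenPairs d N ≤ pairSum a x ∧ uniformOn x ∉ PNDelta d N := by
  obtain ⟨α, hαm, hα, hαlim⟩ := exists_seq_strictMono_tendsto' ha
  choose y hy using fun n => h (α n) (zero_lt_one.trans (hα n).1) (hα n).2
  obtain ⟨x, -, φ, hφ, hx⟩ := isCompact_univ.tendsto_subseq (x := y) fun _ => Set.mem_univ _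
  have hle : ∀ n, evenPairs d N ≤ pairSum (α n) x := by
    intro n
    have h0 : α n ≠ 0 := (zero_lt_one.trans (hα n).1).ne'
    refine ge_of_tendsto (((continuous_pairSum h0 (hα n).2.ne_top).tendsto x).comp hx) ?_
    filter_upwards [eventually_ge_atTop n] with m hm
    exact (hy _).le.trans (pairSum_antitone _ (hαm.monotone (hm.trans (hφ.id_le m))))
  have hxa : evenPairs d N ≤ pairSum a x :=
    ge_of_tendsto (((continuous_pairSum_exponent x).tendsto a).comp hαlim)
      (Eventually.of_forall hle)
  refine ⟨x, hxa, fun hmem => ?_⟩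
  obtain ⟨v, e, he⟩ := exists_basis_of_le_pairSum_top (pairSum_of_mem_PNDelta (by omega) ∞ hmem).ge
  let c : Fin N → Fin (d + 1) := fun i => ⟨e i % (d + 1), Nat.mod_lt _ d.succ_pos⟩
  have hc : Function.Surjective c := fun j => by
    refine ⟨e.symm ⟨j, j.2.trans_le hN⟩, Fin.ext ?_⟩
    simp [c, Nat.mod_eq_of_lt j.2]
  have hD : ∑ i, ∑ k, (if c i ≠ c k then (1 : ℝ) else 0) = evenPairs d N := by
    symm
    unfold evenPairs
    rw [← Equiv.sum_comp e]
    refine Finset.sum_congr rfl fun i _ => ?_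
    rw [← Equiv.sum_comp e]
    simp [c, Fin.ext_iff]
  -- The fixed exponent `α 0 > 1` gives a neighbourhood independent of `n`; by monotonicity it rules
  -- out winners at every later exponent.
  obtain ⟨η, hη, hloc⟩ := exists_pairSum_le_of_near_basis v hc
    (fun i => he i (c i) (Nat.mod_modEq _ _).symm) (hα 0).1 (hα 0).2.ne_top
  obtain ⟨n, hn⟩ := (hx.eventually (Metric.closedBall_mem_nhds x hη)).exists
  have h1 := hloc _ hn
  rw [hD] at h1
  have h2 := pairSum_antitone (y (φ n)) (hαm.monotone (Nat.zero_le (φ n)))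
  have h3 := hy (φ n)
  simp only at h2
  linarith [show pairSum (α 0) (y (φ n)) ≤ evenPairs d N from h1]

/-! ### Competitors for exponents at most 1 -/

/-- Bookkeeping for moving only the two points `p` and `q`: the change `G` lives on their rows and
columns, which are equal by symmetry. -/
lemma sum_sum_nonneg_of_two {ι : Type*} [Fintype ι] [DecidableEq ι] {G : ι → ι → ℝ} {p q : ι}
    (hne : p ≠ q) (hsymm : ∀ i k, G i k = G k i) (hpp : G p p = 0) (hqq : G q q = 0) (hpq : G p q = 0)
    (hoff : ∀ i k, i ≠ p → i ≠ q → k ≠ p → k ≠ q → G i k = 0)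
    (hsum : ∀ k, k ≠ p → k ≠ q → 0 ≤ G p k + G q k) : 0 ≤ ∑ i, ∑ k, G i k := by
  have hqp : G q p = 0 := by rw [hsymm, hpq]
  have h : ∀ i k, G i k = (((if i = p then G p k else 0) + if i = q then G q k else 0) +
      ((if k = p then G p i else 0) + if k = q then G q i else 0)) := by
    intro i k
    by_cases hip : i = p <;> by_cases hiq : i = q <;> by_cases hkp : k = p <;>
      by_cases hkq : k = q <;> simp_all
  have hnn : ∀ k, 0 ≤ G p k + G q k := by
    intro k
    by_cases hkp : k = p
    · simp [hkp, hpp, hqp]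
    by_cases hkq : k = q
    · simp [hkq, hpq, hqq]
    exact hsum k hkp hkq
  have h1 : ∑ i, ∑ k, ((if i = p then G p k else 0) + if i = q then G q k else 0) =
      ∑ k, (G p k + G q k) := by
    rw [Finset.sum_comm]
    simp [Finset.sum_add_distrib]
  have h2 : ∑ i, ∑ k, ((if k = p then G p i else 0) + if k = q then G q i else 0) =
      ∑ k, (G p k + G q k) := by
    simp [Finset.sum_add_distrib]
  have h4 : ∑ i, ∑ k, G i k = ∑ k, (G p k + G q k) + ∑ k, (G p k + G q k) := by
    refine Eq.trans ?_ (congrArg₂ HAdd.hAdd h1 h2)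
    rw [← Finset.sum_add_distrib]
    refine Finset.sum_congr rfl fun i _ => ?_
    rw [← Finset.sum_add_distrib]
    exact Finset.sum_congr rfl fun k _ => h i k
  have h3 := Finset.sum_nonneg fun k (_ : k ∈ Finset.univ) => hnn k
  linarith

/-- The vector with coordinates `a`, `b` in the plane of two vectors of a basis. -/
noncomputable def planeVec (v : OrthonormalBasis (Fin (d + 1)) ℝ (EuclideanSpace ℝ (Fin (d + 1))))
    (p q : Fin (d + 1)) (a b : ℝ) : EuclideanSpace ℝ (Fin (d + 1)) := a • v p + b • v q

lemma inner_planeVec_basis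
    (v : OrthonormalBasis (Fin (d + 1)) ℝ (EuclideanSpace ℝ (Fin (d + 1))))
    (p q l : Fin (d + 1)) (a b : ℝ) :
    inner ℝ (planeVec v p q a b) (v l) = (if p = l then a else 0) + if q = l then b else 0 := by
  simp [planeVec, inner_add_left, real_inner_smul_left, orthonormal_iff_ite.1 v.orthonormal]

lemma inner_planeVec (v : OrthonormalBasis (Fin (d + 1)) ℝ (EuclideanSpace ℝ (Fin (d + 1))))
    {p q : Fin (d + 1)} (hpq : p ≠ q) (a b a' b' : ℝ) :
    inner ℝ (planeVec v p q a b) (planeVec v p q a' b') = a * a' + b * b' := by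
  conv_lhs => rw [planeVec.eq_def v p q a' b']
  rw [inner_add_right, real_inner_smul_right, real_inner_smul_right, inner_planeVec_basis,
    inner_planeVec_basis]
  simp [hpq, hpq.symm, mul_comm]

lemma norm_planeVec (v : OrthonormalBasis (Fin (d + 1)) ℝ (EuclideanSpace ℝ (Fin (d + 1))))
    {p q : Fin (d + 1)} (hpq : p ≠ q) {a b : ℝ} (hab : a * a + b * b = 1) :
    ‖planeVec v p q a b‖ = 1 := by
  have := inner_planeVec v hpq a b a b
  rw [real_inner_self_eq_norm_sq, hab] at this
  exact (pow_eq_one_iff_of_nonneg (norm_nonneg _) two_ne_zero).1 this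

lemma lam_eq_half {x y : Sph d}
    (h : |inner ℝ (x : EuclideanSpace ℝ (Fin (d + 1))) y| = √2 / 2) : lam x y = 1 / 2 := by
  rw [lam_eq, h, ← Real.cos_pi_div_four, Real.arccos_cos (by positivity)
    (by linarith [Real.pi_pos])]
  field_simp
  norm_num

lemma half_le_kernelPow {x y : Sph d} (h : lam x y = 1 / 2) {α : ℝ≥0∞} (hα : α ≤ 1) :
    1 / 2 ≤ kernelPow α x y := by
  have h1 : kernelPow 1 x y ≤ kernelPow α x y := kernelPow_antitone x y hα
  rwa [kernelPow_of_ne_zero _ _ one_ne_zero ENNReal.one_ne_top, ENNReal.toReal_one,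
    Real.rpow_one, h] at h1

/-- Rotating one point on each of two basis lines within their common plane does not decrease the
pair sum for exponents at most `1`. -/
lemma exists_rotated (hd : 1 ≤ d) (hN : d + 2 ≤ N) {α : ℝ≥0∞} (hα : α ≤ 1) :
    ∃ y : Fin N → Sph d, evenPairs d N ≤ pairSum α y ∧ uniformOn y ∉ PNDelta d N := by
  let v := EuclideanSpace.basisFun (Fin (d + 1)) ℝ
  let c : Fin N → Fin (d + 1) := fun i => ⟨i % (d + 1), Nat.mod_lt _ d.succ_pos⟩
  let p : Fin N := ⟨0, by omega⟩
  let q : Fin N := ⟨1, by omega⟩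
  -- A further point in the class of `p`; after the rotation the pair `p`, `r` has `Λ = 1 / 2`, so
  -- the tuple is not even.
  let r : Fin N := ⟨d + 1, by omega⟩
  have hqp : q ≠ p := by simp [p, q]
  have hrp : r ≠ p := by simp [p, r]
  have hrq : r ≠ q := by simp only [q, r, ne_eq, Fin.mk.injEq]; omega
  have hrc : c r = c p := by simp [c, r, p]
  have hpq : c p ≠ c q := by
    simp only [c, p, q, ne_eq, Fin.mk.injEq, Nat.zero_mod, Nat.mod_eq_of_lt (show 1 < d + 1 by omega)]
    omega
  have hs : √2 / 2 * (√2 / 2) = (1 / 2 : ℝ) := by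
    have := Real.mul_self_sqrt (show (0 : ℝ) ≤ 2 by norm_num)
    linarith
  have hs0 : |√2 / 2| = √2 / 2 := abs_of_nonneg (by positivity)
  let y : Fin N → Sph d := fun i =>
    if i = p then toSph (planeVec v (c p) (c q) (√2 / 2) (√2 / 2))
      (norm_planeVec v hpq (by linarith))
    else if i = q then toSph (planeVec v (c p) (c q) (-(√2 / 2)) (√2 / 2))
      (norm_planeVec v hpq (by linarith))
    else toSph (v (c i)) (v.orthonormal.1 _)
  have hyp : (y p : EuclideanSpace ℝ (Fin (d + 1))) =
      planeVec v (c p) (c q) (√2 / 2) (√2 / 2) := by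
    simp [y, toSph]
  have hyq : (y q : EuclideanSpace ℝ (Fin (d + 1))) =
      planeVec v (c p) (c q) (-(√2 / 2)) (√2 / 2) := by
    simp [y, toSph, hqp]
  have hyk : ∀ k, k ≠ p → k ≠ q → (y k : EuclideanSpace ℝ (Fin (d + 1))) = v (c k) := by
    intro k h1 h2
    simp [y, toSph, h1, h2]
  have hhalf : ∀ k, k ≠ p → k ≠ q → (c k = c p ∨ c k = c q) →
      lam (y p) (y k) = 1 / 2 ∧ lam (y q) (y k) = 1 / 2 := by
    intro k h1 h2 hk
    constructor <;> apply lam_eq_half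
    · rw [hyp, hyk k h1 h2, inner_planeVec_basis]
      rcases hk with hk | hk <;> simp [hk, hpq, hpq.symm, hs0]
    · rw [hyq, hyk k h1 h2, inner_planeVec_basis]
      rcases hk with hk | hk <;> simp [hk, hpq, hpq.symm, hs0]
  refine ⟨y, ?_, ?_⟩
  · have hD : evenPairs d N = ∑ i, ∑ k, if c i ≠ c k then 1 else 0 := by
      simp [evenPairs, c, Fin.ext_iff]
    have key : 0 ≤ ∑ i, ∑ k, (kernelPow α (y i) (y k) - if c i ≠ c k then 1 else 0) := by
      refine sum_sum_nonneg_of_two (p := p) (q := q) hqp.symm (fun i k => ?_) ?_ ?_ ?_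
        (fun i k hip hiq hkp hkq => ?_) fun k hkp hkq => ?_
      · rw [kernelPow_comm]
        simp only [ne_comm]
      · simp [kernelPow_of_lam_eq_zero]
      · simp [kernelPow_of_lam_eq_zero]
      · rw [if_pos hpq, kernelPow_of_lam_eq_one, sub_self]
        rw [lam_eq_one_iff, hyp, hyq, inner_planeVec v hpq]
        ring
      · rw [kernelPow_of_basis α v (Or.inl (hyk i hip hiq)) (Or.inl (hyk k hkp hkq)), sub_self]
      · by_cases hk : c k = c p ∨ c k = c q
        · obtain ⟨h1, h2⟩ := hhalf k hkp hkq hk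
          have h1 := half_le_kernelPow h1 hα
          have h2 := half_le_kernelPow h2 hα
          -- One orthogonal pair is traded for two at 45 degrees, each worth at least `1 / 2` since
          -- `α ≤ 1`.
          have h3 : (if c p ≠ c k then (1 : ℝ) else 0) + (if c q ≠ c k then 1 else 0) = 1 := by
            rcases hk with hk | hk <;> simp [hk, hpq, hpq.symm]
          linarith
        · push Not at hk
          have h1 : lam (y p) (y k) = 1 := by
            rw [lam_eq_one_iff, hyp, hyk k hkp hkq, inner_planeVec_basis]
            simp [hk.1.symm, hk.2.symm]
          have h2 : lam (y q) (y k) = 1 := by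
            rw [lam_eq_one_iff, hyq, hyk k hkp hkq, inner_planeVec_basis]
            simp [hk.1.symm, hk.2.symm]
          rw [kernelPow_of_lam_eq_one _ h1, kernelPow_of_lam_eq_one _ h2, if_pos hk.1.symm,
            if_pos hk.2.symm]
          norm_num
    simp only [Finset.sum_sub_distrib] at key
    rw [hD]
    exact sub_nonneg.1 key
  · have := (hhalf r hrp hrq (Or.inl hrc)).1
    exact not_mem_PNDelta (by omega) (i := p) (k := r) (by rw [this]; norm_num)
      (by rw [this]; norm_num)

/-- Pairwise different lines at acute angles do at least as well as the even distributions for the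
exponent `0`. -/
lemma exists_spread (hd : 1 ≤ d) (hN : 2 ≤ N) :
    ∃ y : Fin N → Sph d, evenPairs d N ≤ pairSum 0 y ∧ uniformOn y ∉ PNDelta d N := by
  let v := EuclideanSpace.basisFun (Fin (d + 1)) ℝ
  let p : Fin (d + 1) := ⟨0, by omega⟩
  let q : Fin (d + 1) := ⟨1, by omega⟩
  have hpq : p ≠ q := by simp [p, q]
  -- Distinct angles in `[0, 1)` differ by less than `π / 2`, so `Λ` is strictly between 0 and 1 on
  -- distinct indices.
  let θ : Fin N → ℝ := fun i => (i : ℝ) / N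
  let y : Fin N → Sph d := fun i => toSph (planeVec v p q (Real.cos (θ i)) (Real.sin (θ i)))
    (norm_planeVec v hpq (by nlinarith [Real.cos_sq_add_sin_sq (θ i)]))
  have hN0 : (0 : ℝ) < N := by exact_mod_cast (by omega : 0 < N)
  have hlt : ∀ i k, |θ i - θ k| < 1 := by
    intro i k
    have h0 : ∀ i, 0 ≤ θ i := fun i => by positivity
    have h1 : ∀ i, θ i < 1 := fun i => by
      rw [div_lt_one hN0]
      exact_mod_cast i.2
    rw [abs_lt]
    constructor <;> linarith [h0 i, h0 k, h1 i, h1 k]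
  have hne : ∀ i k, i ≠ k → 0 < |θ i - θ k| := by
    intro i k hik
    rw [abs_pos, sub_ne_zero]
    intro h
    have h := (div_left_inj' hN0.ne').1 h
    exact hik (Fin.ext (by exact_mod_cast h))
  have hlam : ∀ i k, lam (y i) (y k) = 2 / Real.pi * |θ i - θ k| := by
    intro i k
    have h1 : inner ℝ (y i : EuclideanSpace ℝ (Fin (d + 1))) (y k) = Real.cos |θ i - θ k| := by
      rw [Real.cos_abs, Real.cos_sub]
      exact inner_planeVec v hpq _ _ _ _
    have h2 := hlt i k
    have h3 := Real.pi_gt_three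
    rw [lam_eq, h1, abs_of_nonneg, Real.arccos_cos (abs_nonneg _) (by linarith)]
    exact Real.cos_nonneg_of_neg_pi_div_two_le_of_le (by linarith [abs_nonneg (θ i - θ k)])
      (by linarith)
  have hpos : ∀ i k, i ≠ k → 0 < lam (y i) (y k) := by
    intro i k hik
    rw [hlam]
    have := hne i k hik
    positivity
  refine ⟨y, Finset.sum_le_sum fun i _ => Finset.sum_le_sum fun k _ => ?_, ?_⟩
  · by_cases hik : i = k
    · simp [hik, kernelPow_of_lam_eq_zero]
    · rw [kernelPow_of_pos (hpos i k hik) ENNReal.zero_ne_top]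
      simp only [ENNReal.toReal_zero, Real.rpow_zero]
      split_ifs <;> norm_num
  · refine not_mem_PNDelta (by omega) (i := ⟨0, by omega⟩) (k := ⟨1, by omega⟩)
      (hpos _ _ (by simp)) ?_
    rw [hlam]
    have h2 := hlt ⟨0, by omega⟩ ⟨1, by omega⟩
    have h3 : 2 / Real.pi < 1 := by
      rw [div_lt_one Real.pi_pos]
      linarith [Real.pi_gt_three]
    exact mul_lt_one_of_nonneg_of_lt_one_left (by positivity) h3 h2.le

/-- With at most as many points as dimensions, all points of an even distribution are pairwise
orthogonal. -/
lemma pairSum_le_evenPairs_of_le (hN : N ≤ d + 1) (α : ℝ≥0∞) (y : Fin N → Sph d) :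
    pairSum α y ≤ evenPairs d N := by
  refine Finset.sum_le_sum fun i _ => Finset.sum_le_sum fun k _ => ?_
  by_cases hik : i = k
  · simp [hik, kernelPow_of_lam_eq_zero]
  · rw [if_pos]
    · exact kernelPow_le_one _ _ _
    · rw [Nat.mod_eq_of_lt (i.2.trans_le hN), Nat.mod_eq_of_lt (k.2.trans_le hN)]
      exact fun h => hik (Fin.ext h)

/-! ### The threshold exponent -/

lemma not_subset_of_disjoint {α : ℝ≥0∞} (h : Disjoint (PNDelta d N) (argmaxE d N α)) :
    ¬ PNDelta d N ⊆ argmaxE d N α := fun hs => by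
  obtain ⟨x, hx⟩ := exists_mem_PNDelta d N
  exact Set.disjoint_left.1 h hx (hs hx)

lemma exists_isThreshold (hN : 1 ≤ N) : ∃ a, IsThreshold d N a := by
  refine ⟨sInf {α | PNDelta d N ⊆ argmaxE d N α}, fun α _ hα => ?_, fun α hα => ?_⟩
  · exact disjoint_or_subset hN α fun h => (sInf_le h).not_gt hα
  · obtain ⟨β, hβ, hβα⟩ := sInf_lt_iff.1 hα
    exact PNDelta_eq_argmaxE_of_lt hN hβα hβ

lemma IsThreshold.le {a b : ℝ≥0∞} (ha : IsThreshold d N a) (hb : IsThreshold d N b) : b ≤ a := by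
  by_contra! h
  obtain ⟨α, h1, h2⟩ := exists_between h
  exact not_subset_of_disjoint (hb.1 α (zero_le.trans_lt h1) h2) (ha.2 α h1).subset

namespace IsThreshold

variable {a : ℝ≥0∞}

lemma exists_lt (hN : 1 ≤ N) (ha : IsThreshold d N a) {α : ℝ≥0∞} (h0 : 0 < α) (hα : α < a) :
    ∃ y : Fin N → Sph d, evenPairs d N < pairSum α y := by
  have := not_subset_of_disjoint (ha.1 α h0 hα)
  rw [PNDelta_subset_argmaxE_iff hN] at this
  push Not at this
  exact this

lemma le_of_pos (hN : 1 ≤ N) (ha : IsThreshold d N a) (h0 : 0 < a) : d + 2 ≤ N := by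
  by_contra! h
  obtain ⟨α, h1, h2⟩ := exists_between h0
  obtain ⟨y, hy⟩ := ha.exists_lt hN h1 h2
  exact (pairSum_le_evenPairs_of_le (by omega) α y).not_gt hy

lemma lt_top (hN : 1 ≤ N) (ha : IsThreshold d N a) : a < ∞ := by
  by_contra! h
  obtain rfl := top_le_iff.1 h
  have hd := ha.le_of_pos hN ENNReal.zero_lt_top
  obtain ⟨x, hx, hx'⟩ := exists_not_mem_PNDelta (by omega) ENNReal.one_lt_top
    fun α h0 hα => ha.exists_lt hN h0 hα
  exact hx' (mem_PNDelta_of_le_pairSum_top hx)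

lemma subset (hN : 1 ≤ N) (ha : IsThreshold d N a) : PNDelta d N ⊆ argmaxE d N a := by
  rw [PNDelta_subset_argmaxE_iff hN]
  intro y
  -- Finiteness of `a` is what allows approaching it from above.
  have hne : (𝓝[>] a).NeBot := nhdsGT_neBot_of_exists_gt ⟨∞, ha.lt_top hN⟩
  refine le_of_tendsto ((continuous_pairSum_exponent y).continuousWithinAt (s := Set.Ioi a)) ?_
  filter_upwards [self_mem_nhdsWithin] with α hα
  exact (PNDelta_subset_argmaxE_iff hN α).1 (ha.2 α hα).subset y

lemma ssubset (hd : 1 ≤ d) (hN : 2 ≤ N) (ha : IsThreshold d N a) :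
    PNDelta d N ⊂ argmaxE d N a := by
  have hsub := ha.subset (by omega)
  have : ∃ y : Fin N → Sph d, evenPairs d N ≤ pairSum a y ∧ uniformOn y ∉ PNDelta d N := by
    rcases eq_zero_or_pos (a := a) with rfl | h0
    · exact exists_spread hd hN
    have hdN := ha.le_of_pos (by omega) h0
    rcases le_or_gt a 1 with h1 | h1
    · exact exists_rotated hd hdN h1
    · exact exists_not_mem_PNDelta (by omega) h1 fun α h0 hα => ha.exists_lt (by omega) h0 hα
  obtain ⟨y, hy, hy'⟩ := this
  exact ⟨hsub, fun h => hy' (h (mem_argmaxE_of_le (by omega) hsub hy))⟩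

end IsThreshold

end FejesToth

theorem theorem4p4 (d N : ℕ) (hd : 1 ≤ d) (hN : 1 ≤ N) :
    (∃! a : ℝ≥0∞, FejesToth.IsThreshold d N a) ∧
    ∀ a : ℝ≥0∞, FejesToth.IsThreshold d N a →
      a < ∞ ∧
      FejesToth.PNDelta d N ⊆ FejesToth.argmaxE d N a ∧
      (2 ≤ N → FejesToth.PNDelta d N ⊂ FejesToth.argmaxE d N a) := by
  refine ⟨?_, fun a ha => ⟨ha.lt_top hN, ha.subset hN, fun h2 => ha.ssubset hd h2⟩⟩
  obtain ⟨a, ha⟩ := FejesToth.exists_isThreshold (d := d) hN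
  exact ⟨a, ha, fun b hb => le_antisymm (ha.le hb) (hb.le ha)⟩
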